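/- Let $\mathbb T$ be the unit circle with normalised Lebesgue measure, $L^p=L^p(\mathbb T)$, let $H^2_+\subset L^2$ be the Hardy space of functions whose negative Fourier coefficients vanish, $H^2_-=(H^2_+)^\perp$, and let $P^\pm$ be the orthogonal projections of $L^2$ onto $H^2_\pm$. Let $H^\infty=L^\infty\cap H^2_+$ and $\overline{H^\infty}=\{\bar h: h\in H^\infty\}$. A function $f\in H^2_+$ is outer if the closed linear span of $\{z^nf:n\ge 0\}$ is $H^2_+$; $f\in H^2_-$ is outer if $\bar z\bar f$ is outer in $H^2_+$; $h\in H^\infty$ is outer if it is outer as an element of $H^2_+$, and $h\in\overline{H^\infty}$ is outer if $\bar h$ is. A function $\theta\in H^\infty$ is inner if $|\theta|=1$ a.e., and $h\in H^\infty$ has a nonconstant inner factor if $h=\theta g$ with $\theta$ inner and nonconstant and $g\in H^\infty$. For $a,b\in L^\infty$ let $\Sigma_{a,b}:L^2\to L^2$, $\Sigma_{a,b}f=P^+(af)+P^-(bf)$. Let $a,b\in L^\infty$ with $a\neq 0$ and $b\ne 0$ a.e. on $\mathbb T$, and suppose that $\ker\Sigma_{a,b}\neq\{0\}$. Then: (i)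 for all $\tilde a,\tilde b\in L^\infty$, $\ker\Sigma_{a,b}\subseteq\ker\Sigma_{\tilde a,\tilde b}$ if and only if $\tilde a/a=\tilde\psi_- /\psi_-$ a.e. for some $\psi_-,\tilde\psi_-\in H^2_-$ with $\psi_-$ outer, and $\tilde b/b=\tilde\psi_+/\psi_+$ a.e. for some $\psi_+,\tilde\psi_+\in H^2_+$ with $\psi_+$ outer; (ii) for all $\tilde a,\tilde b\in L^\infty$, $\ker\Sigma_{a,b}=\ker\Sigma_{\tilde a,\tilde b}$ if and only if $\tilde a/a$ and $\tilde b/b$ can be written as in (i) with, in addition, $\tilde\psi_-$ outer in $H^2_-$ and $\tilde\psi_+$ outer in $H^2_+$; (iii) for all $h_-\in\overline{H^\infty}$ and $h_+\in H^\infty$, $$\ker\Sigma_{a,b}\subseteq\ker\Sigma_{ah_-,\,bh_+},$$ where the inclusion is strict if $\overline{h_-}$ or $h_+$ has a nonconstant inner factor, and equality holds if $h_-$ and $h_+$ are both outer. -/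

import Mathlib

open MeasureTheory AddCircle
open scoped ENNReal

namespace TransposedPaired

/-- Normalised Lebesgue measure on the unit circle.  The circle is modelled as `ℝ / ℤ`, with the
independent variable `z = e^{2πit}`, so that `z ^ n` is `fourier n`. -/
noncomputable abbrev circleMeasure : Measure UnitAddCircle := haarAddCircle

/-- `L²(𝕋)`. -/
noncomputable abbrev L2 : Type := Lp ℂ 2 circleMeasure

/-- `L^∞(𝕋)`. -/
noncomputable abbrev Linf : Type := Lp ℂ ∞ circleMeasure

/-- The Hardy space `H²₊`: the functions in `L²(𝕋)` whose negative Fourier coefficients vanish. -/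
noncomputable def H2Plus : Submodule ℂ L2 where
  carrier := {f | ∀ n : ℤ, n < 0 → fourierCoeff f n = 0}
  add_mem' := by
    intro f g hf hg n hn
    have h1 := hf n hn
    have h2 := hg n hn
    rw [← fourierBasis_repr] at h1 h2 ⊢
    rw [map_add, lp.coeFn_add, Pi.add_apply, h1, h2, add_zero]
  zero_mem' := by
    intro n _
    rw [← fourierBasis_repr, map_zero, lp.coeFn_zero, Pi.zero_apply]
  smul_mem' := by
    intro c f hf n hn
    have h1 := hf n hn
    rw [← fourierBasis_repr] at h1 ⊢
    rw [map_smul, lp.coeFn_smul, Pi.smul_apply, h1, smul_zero]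

theorem mem_H2Plus {f : L2} : f ∈ H2Plus ↔ ∀ n : ℤ, n < 0 → fourierCoeff f n = 0 := Iff.rfl

theorem isClosed_H2Plus : IsClosed (H2Plus : Set L2) := by
  have h : (H2Plus : Set L2) =
      ⋂ n : ℤ, ⋂ _ : n < 0, {f : L2 | inner ℂ (fourierLp 2 n : L2) f = 0} := by
    ext f
    simp only [SetLike.mem_coe, mem_H2Plus, Set.mem_iInter, Set.mem_ofPred_eq,
      ← fourierBasis_repr, HilbertBasis.repr_apply_apply, coe_fourierBasis]
  rw [h]
  exact isClosed_iInter fun n => isClosed_iInter fun _ =>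
    isClosed_eq (by fun_prop) continuous_const

instance : CompleteSpace H2Plus := isClosed_H2Plus.completeSpace_coe

/-- `H²₋ = (H²₊)^⊥`. -/
noncomputable def H2Minus : Submodule ℂ L2 := H2Plusᗮ

/-- The orthogonal projection `P⁺` of `L²(𝕋)` onto `H²₊`. -/
noncomputable def projPlus : L2 →L[ℂ] L2 := H2Plus.starProjection

instance : CompleteSpace H2Minus := (Submodule.isClosed_orthogonal H2Plus).completeSpace_coe

/-- The orthogonal projection `P⁻` of `L²(𝕋)` onto `H²₋`. -/
noncomputable def projMinus : L2 →L[ℂ] L2 := H2Minus.starProjection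

/-- The multiplication operator `M_a : f ↦ a f` on `L²(𝕋)`, for `a ∈ L^∞(𝕋)`. -/
noncomputable def mulOp (a : Linf) : L2 →L[ℂ] L2 :=
  (ContinuousLinearMap.mul ℂ ℂ).holderL circleMeasure ∞ 2 2 a

/-- The product of two functions in `L^∞(𝕋)`. -/
noncomputable def linfMul (a b : Linf) : Linf :=
  (ContinuousLinearMap.mul ℂ ℂ).holder ∞ a b

theorem coeFn_mulOp (a : Linf) (f : L2) :
    mulOp a f =ᵐ[circleMeasure] fun t => a t * f t :=
  (ContinuousLinearMap.mul ℂ ℂ).coeFn_holder a f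

theorem coeFn_linfMul (a b : Linf) :
    linfMul a b =ᵐ[circleMeasure] fun t => a t * b t :=
  (ContinuousLinearMap.mul ℂ ℂ).coeFn_holder a b

/-- The transposed paired operator `Σ_{a,b} = P⁺ a I + P⁻ b I` on `L²(𝕋)`. -/
noncomputable def transposedPairedOp (a b : Linf) : L2 →L[ℂ] L2 :=
  projPlus ∘L mulOp a + projMinus ∘L mulOp b

/-- The transposed paired kernel `ker Σ_{a,b}`. -/
noncomputable def kerSigma (a b : Linf) : Submodule ℂ L2 :=
  LinearMap.ker (transposedPairedOp a b : L2 →ₗ[ℂ] L2)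

/-- The inclusion `L^∞(𝕋) ⊆ L²(𝕋)`. -/
noncomputable def toL2 (h : Linf) : L2 := ((Lp.memLp h).mono_exponent le_top).toLp h

/-- `h ∈ H^∞`: a function in `L^∞(𝕋)` whose negative Fourier coefficients vanish.  Membership of
`h` in the space of complex conjugates of `H^∞` functions is `IsHInf (star h)`, where `star` is
pointwise complex conjugation. -/
def IsHInf (h : Linf) : Prop := ∀ n : ℤ, n < 0 → fourierCoeff h n = 0

/-- `f` is an outer function in `H²₊`: the closed linear span of `f, zf, z²f, …` is `H²₊`. -/
def IsOuterPlus (f : L2) : Prop :=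
  (Submodule.span ℂ (Set.range fun n : ℕ => mulOp (fourierLp ∞ (n : ℤ)) f)).topologicalClosure
    = H2Plus

/-- `f` is an outer function in `H²₋`: the function `z̄ f̄` is outer in `H²₊`. -/
def IsOuterMinus (f : L2) : Prop := IsOuterPlus (mulOp (fourierLp ∞ (-1)) (star f))

/-- `h` is an outer function in `H^∞`. -/
def IsOuterInf (h : Linf) : Prop := IsHInf h ∧ IsOuterPlus (toL2 h)

/-- `θ` is an inner function. -/
def IsInner (θ : Linf) : Prop := IsHInf θ ∧ ∀ᵐ t ∂circleMeasure, ‖θ t‖ = 1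

/-- `h` has a nonconstant inner factor: `h = θ g` with `θ` inner and nonconstant, `g ∈ H^∞`. -/
def HasNonconstantInnerFactor (h : Linf) : Prop :=
  ∃ θ g : Linf, IsInner θ ∧ (¬ ∃ c : ℂ, ∀ᵐ t ∂circleMeasure, θ t = c) ∧ IsHInf g ∧
    h = linfMul θ g

end TransposedPaired

open TransposedPaired

namespace TransposedPaired

/-! The two summands of `Σ_{a,b} f` lie in orthogonal subspaces, so `f` is in the kernel exactly
when `af ∈ H²₋` and `bf ∈ H²₊` (`mem_kerSigma`).

Two facts about outer functions carry the argument. An `L²` function whose product with an outer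
function is analytic is itself in `H²₊` (`IsOuterPlus.mem_H2Plus_of_product`); with `b'f · ψ₊ = ψ₊'
· bf`, this turns the quotient conditions into kernel inclusions. And an outer function cannot be
divided within `H²₊` by a nonconstant inner one (`IsOuterPlus.inner_eq_const`).

Conversely, take `f ≠ 0` in the kernel and factor `bf = θO` with `θ` inner and `O` outer. Since `θ̄`
preserves `H²₋`, `θ̄f` is again in the kernel, so some `f` there has `bf` outer
(`exists_mem_kerSigma_isOuterPlus`). Under an inclusion, `b'/b = b'f/bf` is the required quotient.
Under equality, an inner factor of `b'f` could be divided out of `f` inside the common kernel, hence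
out of the outer function `bf`, so it is constant. The same division gives the strict inclusions.

The `H²₋` half follows from the `H²₊` half through `f ↦ z̄f̄`. Inner-outer factorization is obtained
by Beurling's wandering vector argument. -/

/-! ### Multiplication operators, shifts and Fourier coefficients. -/

theorem coeFn_shift (n : ℤ) (f : L2) :
    mulOp (fourierLp ∞ n) f =ᵐ[circleMeasure] fun t => fourier n t * f t := by
  filter_upwards [coeFn_mulOp (fourierLp ∞ n) f,
    coeFn_fourierLp (T := (1 : ℝ)) ∞ n] with t h1 h2
  rw [h1, h2]

theorem mulOp_linfMul (a b : Linf) (f : L2) : mulOp (linfMul a b) f = mulOp a (mulOp b f) := by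
  refine Lp.ext ?_
  filter_upwards [coeFn_mulOp (linfMul a b) f, coeFn_mulOp a (mulOp b f), coeFn_mulOp b f,
    coeFn_linfMul a b] with t h1 h2 h3 h4
  rw [h1, h2, h3, h4, mul_assoc]

theorem mulOp_comm (a b : Linf) (f : L2) : mulOp a (mulOp b f) = mulOp b (mulOp a f) := by
  refine Lp.ext ?_
  filter_upwards [coeFn_mulOp a (mulOp b f), coeFn_mulOp b f, coeFn_mulOp b (mulOp a f),
    coeFn_mulOp a f] with t h1 h2 h3 h4
  rw [h1, h2, h3, h4, mul_left_comm]

theorem linfMul_star (a b : Linf) : star (linfMul a b) = linfMul (star a) (star b) := by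
  refine Lp.ext ?_
  filter_upwards [Lp.coeFn_star (linfMul a b), coeFn_linfMul a b, coeFn_linfMul (star a) (star b),
    Lp.coeFn_star a, Lp.coeFn_star b] with t h1 h2 h3 h4 h5
  rw [h1, h3, h4, h5, Pi.star_apply, h2, star_mul', Pi.star_apply, Pi.star_apply]

theorem inner_mulOp_left (h : Linf) (u v : L2) :
    inner ℂ (mulOp h u) v = inner ℂ u (mulOp (star h) v) := by
  rw [L2.inner_def, L2.inner_def]
  refine integral_congr_ae ?_
  filter_upwards [coeFn_mulOp h u, coeFn_mulOp (star h) v, Lp.coeFn_star h] with t h1 h2 h3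
  rw [h1, h2, h3]
  simp only [RCLike.inner_apply, map_mul, Pi.star_apply, RCLike.star_def]
  ring

theorem shift_add (m n : ℤ) (f : L2) :
    mulOp (fourierLp ∞ m) (mulOp (fourierLp ∞ n) f) = mulOp (fourierLp ∞ (m + n)) f := by
  refine Lp.ext ?_
  filter_upwards [coeFn_shift m (mulOp (fourierLp ∞ n) f), coeFn_shift n f,
    coeFn_shift (m + n) f] with t h1 h2 h3
  rw [h1, h2, h3, fourier_add, mul_assoc]

theorem shift_zero (f : L2) : mulOp (fourierLp ∞ 0) f = f := by
  refine Lp.ext ?_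
  filter_upwards [coeFn_shift 0 f] with t h1
  rw [h1, fourier_zero, one_mul]

theorem shift_fourierLp (m n : ℤ) :
    mulOp (fourierLp ∞ m) (fourierLp 2 n) = fourierLp 2 (m + n) := by
  refine Lp.ext ?_
  filter_upwards [coeFn_shift m (fourierLp 2 n), coeFn_fourierLp (T := (1 : ℝ)) 2 n,
    coeFn_fourierLp (T := (1 : ℝ)) 2 (m + n)] with t h1 h2 h3
  rw [h1, h2, h3, fourier_add]

theorem star_fourierLp (n : ℤ) : star (fourierLp ∞ n : Linf) = fourierLp ∞ (-n) := by
  refine Lp.ext ?_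
  filter_upwards [Lp.coeFn_star (fourierLp ∞ n : Linf), coeFn_fourierLp (T := (1 : ℝ)) ∞ n,
    coeFn_fourierLp (T := (1 : ℝ)) ∞ (-n)] with t h1 h2 h3
  rw [h1, h3, Pi.star_apply, h2, fourier_neg, RCLike.star_def]

theorem fourierCoeff_eq_inner (f : L2) (n : ℤ) :
    fourierCoeff f n = inner ℂ (fourierLp 2 n : L2) f := by
  rw [← fourierBasis_repr, HilbertBasis.repr_apply_apply, coe_fourierBasis]

theorem fourierCoeff_shift (k n : ℤ) (f : L2) :
    fourierCoeff (mulOp (fourierLp ∞ k) f) n = fourierCoeff f (n - k) := by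
  have h := inner_mulOp_left (fourierLp ∞ (-k)) (fourierLp 2 n) f
  rw [star_fourierLp, neg_neg, shift_fourierLp] at h
  rw [fourierCoeff_eq_inner, fourierCoeff_eq_inner, ← h, sub_eq_neg_add]

theorem fourierCoeff_star (f : L2) (n : ℤ) :
    fourierCoeff (star f : L2) n = star (fourierCoeff f (-n)) := by
  rw [fourierCoeff_congr_ae (Lp.coeFn_star f), fourierCoeff, fourierCoeff, RCLike.star_def,
    ← integral_conj]
  refine integral_congr_ae (.of_forall fun t => ?_)
  simp [fourier_neg, -fourier_apply]

theorem L2_eq_zero_of_fourierCoeff {f : L2} (h : ∀ n, fourierCoeff f n = 0) : f = 0 := by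
  apply (fourierBasis (T := (1 : ℝ))).repr.injective
  ext n
  rw [fourierBasis_repr, h, map_zero]
  rfl

theorem fourierCoeff_fourierLp (m n : ℤ) :
    fourierCoeff (fourierLp 2 m : L2) n = if n = m then 1 else 0 := by
  rw [fourierCoeff_eq_inner]
  exact (orthonormal_iff_ite.mp (orthonormal_fourier (T := (1 : ℝ)))) n m

theorem fourierLp_mem_H2Plus {n : ℤ} (hn : 0 ≤ n) : (fourierLp 2 n : L2) ∈ H2Plus := by
  intro m hm
  rw [fourierCoeff_fourierLp, if_neg (by omega)]

theorem mem_H2Minus {f : L2} : f ∈ H2Minus ↔ ∀ n : ℤ, 0 ≤ n → fourierCoeff f n = 0 := by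
  constructor
  · intro hf n hn
    rw [fourierCoeff_eq_inner]
    exact (Submodule.mem_orthogonal _ _).mp hf _ (fourierLp_mem_H2Plus hn)
  · intro hf
    refine (Submodule.mem_orthogonal _ _).mpr fun u hu => ?_
    rw [← (fourierBasis (T := (1 : ℝ))).tsum_inner_mul_inner u f]
    refine (tsum_congr fun n => ?_).trans tsum_zero
    rw [coe_fourierBasis, ← fourierCoeff_eq_inner]
    rcases lt_or_ge n 0 with hn | hn
    · rw [← inner_conj_symm, ← fourierCoeff_eq_inner, hu n hn, map_zero, zero_mul]
    · rw [hf n hn, mul_zero]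

/-! ### Cyclic subspaces of the shift. -/

/-- The closed shift-invariant subspace generated by `f`. -/
noncomputable def cyclicSubspace (f : L2) : Submodule ℂ L2 :=
  (Submodule.span ℂ
    (Set.range fun n : ℕ => mulOp (fourierLp ∞ (n : ℤ)) f)).topologicalClosure

theorem isOuterPlus_iff_cyclicSubspace {f : L2} : IsOuterPlus f ↔ cyclicSubspace f = H2Plus :=
  Iff.rfl

theorem cyclicSubspace_le {f : L2} {K : Submodule ℂ L2} (hK : IsClosed (K : Set L2))
    (h : ∀ n : ℕ, mulOp (fourierLp ∞ (n : ℤ)) f ∈ K) : cyclicSubspace f ≤ K := by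
  refine Submodule.topologicalClosure_minimal _ (Submodule.span_le.mpr ?_) hK
  rintro _ ⟨n, rfl⟩
  exact h n

theorem cyclicSubspace_le_comap {f : L2} {K : Submodule ℂ L2} (hK : IsClosed (K : Set L2))
    (T : L2 →L[ℂ] L2) (h : ∀ n : ℕ, T (mulOp (fourierLp ∞ (n : ℤ)) f) ∈ K) :
    ∀ u ∈ cyclicSubspace f, T u ∈ K := by
  have := cyclicSubspace_le (f := f) (K := K.comap (T : L2 →ₗ[ℂ] L2)) (hK.preimage T.continuous) h
  exact fun u hu => this hu

theorem isClosed_cyclicSubspace (f : L2) : IsClosed (cyclicSubspace f : Set L2) :=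
  Submodule.isClosed_topologicalClosure _

theorem shift_mem_cyclicSubspace (f : L2) (n : ℕ) :
    mulOp (fourierLp ∞ (n : ℤ)) f ∈ cyclicSubspace f :=
  Submodule.le_topologicalClosure _ (Submodule.subset_span ⟨n, rfl⟩)

theorem self_mem_cyclicSubspace (f : L2) : f ∈ cyclicSubspace f := by
  simpa [shift_zero] using shift_mem_cyclicSubspace f 0

theorem shift_mem_cyclicSubspace_of_mem {f u : L2} (hu : u ∈ cyclicSubspace f) (k : ℕ) :
    mulOp (fourierLp ∞ (k : ℤ)) u ∈ cyclicSubspace f := by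
  refine cyclicSubspace_le_comap (isClosed_cyclicSubspace f) _ (fun n => ?_) u hu
  rw [shift_add]
  exact_mod_cast shift_mem_cyclicSubspace f (k + n)

theorem shift_mem_H2Plus {f : L2} (hf : f ∈ H2Plus) {k : ℤ} (hk : 0 ≤ k) :
    mulOp (fourierLp ∞ k) f ∈ H2Plus := by
  intro n hn
  rw [fourierCoeff_shift]
  exact hf _ (by omega)

theorem cyclicSubspace_le_H2Plus {f : L2} (hf : f ∈ H2Plus) : cyclicSubspace f ≤ H2Plus :=
  cyclicSubspace_le isClosed_H2Plus fun n => shift_mem_H2Plus hf n.cast_nonneg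

theorem isOuterPlus_one : IsOuterPlus (fourierLp 2 0) := by
  refine le_antisymm (cyclicSubspace_le_H2Plus (fourierLp_mem_H2Plus le_rfl)) fun f hf => ?_
  have hs := hasSum_fourier_series_L2 f
  refine (isClosed_cyclicSubspace (fourierLp 2 0)).mem_of_tendsto hs (.of_forall fun s => ?_)
  refine Submodule.sum_mem _ fun n _ => ?_
  rcases lt_or_ge n 0 with hn | hn
  · rw [hf n hn, zero_smul]
    exact Submodule.zero_mem _
  · refine Submodule.smul_mem _ _ ?_
    lift n to ℕ using hn
    have := shift_mem_cyclicSubspace (fourierLp 2 0) n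
    rwa [shift_fourierLp, add_zero] at this

/-- The constant `1` generates `H²₊`, so a closed shift-invariant subspace containing `1` contains
all of `H²₊`; outerness is thus tested on one vector. -/
theorem isOuterPlus_iff {f : L2} :
    IsOuterPlus f ↔ f ∈ H2Plus ∧ (fourierLp 2 0 : L2) ∈ cyclicSubspace f := by
  constructor
  · intro h
    rw [isOuterPlus_iff_cyclicSubspace] at h
    exact ⟨h ▸ self_mem_cyclicSubspace f, h ▸ fourierLp_mem_H2Plus le_rfl⟩
  · rintro ⟨h1, h2⟩
    refine le_antisymm (cyclicSubspace_le_H2Plus h1) ?_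
    rw [← isOuterPlus_one]
    exact cyclicSubspace_le (isClosed_cyclicSubspace f)
      fun n => shift_mem_cyclicSubspace_of_mem h2 n

/-! ### The action of `H^∞` on the Hardy spaces. -/

theorem isHInf_iff {h : Linf} : IsHInf h ↔ toL2 h ∈ H2Plus := by
  rw [mem_H2Plus, toL2, fourierCoeff_congr_ae (MemLp.coeFn_toLp _)]
  rfl

theorem coeFn_toL2 (h : Linf) : toL2 h =ᵐ[circleMeasure] h := MemLp.coeFn_toLp _

theorem mulOp_fourierLp_zero (h : Linf) : mulOp h (fourierLp 2 0) = toL2 h := by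
  refine Lp.ext ?_
  filter_upwards [coeFn_mulOp h (fourierLp 2 0), coeFn_toL2 h,
    coeFn_fourierLp (T := (1 : ℝ)) 2 0] with t h1 h2 h3
  rw [h1, h2, h3, fourier_zero, mul_one]

theorem IsHInf.mulOp_mem_H2Plus {h : Linf} (hh : IsHInf h) {f : L2} (hf : f ∈ H2Plus) :
    mulOp h f ∈ H2Plus := by
  rw [← isOuterPlus_one] at hf
  refine cyclicSubspace_le_comap isClosed_H2Plus _ (fun n => ?_) f hf
  rw [mulOp_comm, mulOp_fourierLp_zero]
  exact shift_mem_H2Plus (isHInf_iff.mp hh) n.cast_nonneg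

theorem IsHInf.mulOp_star_mem_H2Minus {h : Linf} (hh : IsHInf h) {f : L2} (hf : f ∈ H2Minus) :
    mulOp (star h) f ∈ H2Minus := by
  refine (Submodule.mem_orthogonal _ _).mpr fun u hu => ?_
  rw [← inner_mulOp_left]
  exact (Submodule.mem_orthogonal _ _).mp hf _ (hh.mulOp_mem_H2Plus hu)

/-! ### Products with outer functions. -/

/-- The functional `u ↦ (u g)^(n)` on `L²(𝕋)`. -/
noncomputable def productCoeff (g : L2) (n : ℤ) : L2 →L[ℂ] ℂ :=
  innerSL ℂ (star (mulOp (fourierLp ∞ (-n)) g))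

theorem productCoeff_apply (g u : L2) (n : ℤ) :
    productCoeff g n u = fourierCoeff (fun t => u t * g t) n := by
  rw [productCoeff, innerSL_apply_apply, L2.inner_def, fourierCoeff]
  refine integral_congr_ae ?_
  filter_upwards [Lp.coeFn_star (mulOp (fourierLp ∞ (-n)) g), coeFn_shift (-n) g] with t h1 h2
  rw [h1, Pi.star_apply, h2]
  simp only [RCLike.inner_apply, RCLike.star_def, Complex.conj_conj, smul_eq_mul]
  ring

theorem productCoeff_shift (g u : L2) (n k : ℤ) :
    productCoeff g n (mulOp (fourierLp ∞ k) u) = productCoeff g (n - k) u := by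
  rw [productCoeff_apply, productCoeff_apply]
  refine integral_congr_ae ?_
  filter_upwards [coeFn_shift k u] with t h1
  rw [h1, neg_sub, sub_eq_neg_add, fourier_add]
  simp only [smul_eq_mul]
  ring

theorem productCoeff_one (g : L2) (n : ℤ) :
    productCoeff g n (fourierLp 2 0) = fourierCoeff g n := by
  rw [productCoeff_apply]
  refine integral_congr_ae ?_
  filter_upwards [coeFn_fourierLp (T := (1 : ℝ)) 2 0] with t h1
  rw [h1, fourier_zero, one_mul]

/-- A product of two `L²` functions is only in `L¹`, but for fixed `g` each of its coefficients is
continuous in the other factor. A forward shift of that factor only lowers the index, so the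
vanishing spreads to the closed span. -/
theorem productCoeff_eq_zero_of_mem_cyclicSubspace {g ψ : L2}
    (h : ∀ n < 0, productCoeff g n ψ = 0) {u : L2} (hu : u ∈ cyclicSubspace ψ) :
    ∀ n < 0, productCoeff g n u = 0 := by
  intro n hn
  have := cyclicSubspace_le (f := ψ)
    (K := LinearMap.ker (productCoeff g n : L2 →ₗ[ℂ] ℂ)) (productCoeff g n).isClosed_ker
    (fun k => by
      change productCoeff g n _ = 0
      rw [productCoeff_shift]
      exact h _ (by omega))
  exact this hu

theorem productCoeff_eq_zero {f g : L2} (hf : f ∈ H2Plus) (hg : g ∈ H2Plus) :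
    ∀ n < 0, productCoeff g n f = 0 := by
  rw [← isOuterPlus_one] at hf
  refine productCoeff_eq_zero_of_mem_cyclicSubspace (fun n hn => ?_) hf
  rw [productCoeff_one]
  exact hg n hn

/-- An `L²` function whose product with an outer function is analytic is itself analytic. -/
theorem IsOuterPlus.mem_H2Plus_of_product {ψ g : L2} (hψ : IsOuterPlus ψ)
    (h : ∀ n < 0, productCoeff g n ψ = 0) : g ∈ H2Plus := by
  intro n hn
  -- The vanishing passes from `ψ` to the constant `1`, where the coefficients are those of `g`.
  rw [← productCoeff_one]
  exact productCoeff_eq_zero_of_mem_cyclicSubspace h (isOuterPlus_iff.mp hψ).2 n hn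

theorem productCoeff_congr {f g f' g' : L2}
    (h : ∀ᵐ t ∂circleMeasure, f t * g t = f' t * g' t) (n : ℤ) :
    productCoeff g n f = productCoeff g' n f' := by
  rw [productCoeff_apply, productCoeff_apply, fourierCoeff_congr_ae h]

/-- Multiplication by the indicator of the zero set kills `ψ` and its shifts, hence also the
constant `1` in their closed span; so the indicator is zero. -/
theorem IsOuterPlus.ae_ne_zero {ψ : L2} (hψ : IsOuterPlus ψ) :
    ∀ᵐ t ∂circleMeasure, ψ t ≠ 0 := by
  have hm : MeasurableSet {t | ψ t = 0} :=
    (Lp.stronglyMeasurable ψ).measurable (measurableSet_singleton 0)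
  set χ : Linf := indicatorConstLp ∞ hm (measure_ne_top circleMeasure _) 1 with hχ
  have hχt : χ =ᵐ[circleMeasure] {t | ψ t = 0}.indicator fun _ => (1 : ℂ) :=
    indicatorConstLp_coeFn
  have hz : mulOp χ (fourierLp 2 0) = 0 := by
    have := cyclicSubspace_le (f := ψ)
      (K := LinearMap.ker (mulOp χ : L2 →ₗ[ℂ] L2)) (mulOp χ).isClosed_ker
      (fun k => by
        change mulOp χ _ = 0
        rw [mulOp_comm]
        have : mulOp χ ψ = 0 := by
          refine Lp.ext ?_
          filter_upwards [coeFn_mulOp χ ψ, hχt, Lp.coeFn_zero ℂ 2 circleMeasure] with t h1 h2 h3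
          rw [h1, h2, h3]
          by_cases ht : ψ t = 0 <;> simp [ht]
        rw [this, map_zero])
    exact this (isOuterPlus_iff.mp hψ).2
  rw [mulOp_fourierLp_zero] at hz
  filter_upwards [coeFn_toL2 χ, hχt, Lp.coeFn_zero ℂ 2 circleMeasure] with t h1 h2 h3 h4
  rw [hz, h3, h2, Set.indicator_of_mem (by exact h4)] at h1
  simp at h1

theorem IsOuterPlus.ne_zero {ψ : L2} (hψ : IsOuterPlus ψ) : ψ ≠ 0 := by
  rintro rfl
  have := hψ.ae_ne_zero.and (Lp.coeFn_zero ℂ 2 circleMeasure)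
  obtain ⟨t, ht⟩ := this.exists
  exact ht.1 ht.2

theorem IsOuterPlus.smul {ψ : L2} (hψ : IsOuterPlus ψ) {c : ℂ} (hc : c ≠ 0) :
    IsOuterPlus (c • ψ) := by
  rw [isOuterPlus_iff] at hψ ⊢
  refine ⟨Submodule.smul_mem _ _ hψ.1, cyclicSubspace_le (isClosed_cyclicSubspace _)
    (fun n => ?_) hψ.2⟩
  have := Submodule.smul_mem _ c⁻¹ (shift_mem_cyclicSubspace (c • ψ) n)
  rwa [map_smul, inv_smul_smul₀ hc] at this

/-! ### Inner-outer factorization. -/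

/-- Trigonometric polynomials form a point-separating star subalgebra, which determines finite
measures. -/
theorem measure_ext_of_integral_fourier {P Q : Measure UnitAddCircle} [IsFiniteMeasure P]
    [IsFiniteMeasure Q] (h : ∀ n : ℤ, ∫ t, (fourier n t : ℂ) ∂P = ∫ t, (fourier n t : ℂ) ∂Q) :
    P = Q := by
  refine ext_of_forall_mem_subalgebra_integral_eq_of_pseudoEMetric_complete_countable (𝕜 := ℂ)
    (A := (fourierSubalgebra (T := (1 : ℝ))).comap
      (BoundedContinuousFunction.toContinuousMapStarₐ ℂ)) ?_ ?_
  · intro x y hxy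
    obtain ⟨_, ⟨f, hf, rfl⟩, hne⟩ := fourierSubalgebra_separatesPoints (T := (1 : ℝ)) hxy
    exact ⟨_, ⟨f, ⟨BoundedContinuousFunction.mkOfCompact f, hf, rfl⟩, rfl⟩, hne⟩
  · intro g hg
    have hg' : (BoundedContinuousFunction.toContinuousMapStarₐ ℂ g : C(UnitAddCircle, ℂ)) ∈
        Submodule.span ℂ (Set.range (fourier (T := (1 : ℝ)))) := by
      rw [← fourierSubalgebra_coe]
      exact hg
    have key : ∀ f ∈ Submodule.span ℂ (Set.range (fourier (T := (1 : ℝ)))),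
        ∫ t, f t ∂P = ∫ t, f t ∂Q := by
      intro f hf
      have hint : ∀ (R : Measure UnitAddCircle) [IsFiniteMeasure R] (u : C(UnitAddCircle, ℂ)),
          Integrable (fun t => u t) R := fun R _ u =>
        (BoundedContinuousFunction.mkOfCompact u).integrable R
      induction hf using Submodule.span_induction with
      | mem x hx =>
        obtain ⟨n, rfl⟩ := hx
        exact h n
      | zero => simp
      | add x y _ _ hx hy =>
        simp only [ContinuousMap.add_apply]
        rw [integral_add (hint P x) (hint P y), integral_add (hint Q x) (hint Q y), hx, hy]
      | smul c x _ hx =>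
        simp only [ContinuousMap.smul_apply]
        rw [integral_smul, integral_smul, hx]
    exact key _ hg'

/-- A unit vector of `L²(𝕋)` orthogonal to its shifts is unimodular. -/
theorem ae_norm_eq_one_of_orthogonal_shift {I : L2} (hI : ‖I‖ = 1)
    (h : ∀ n : ℕ, n ≠ 0 → inner ℂ (mulOp (fourierLp ∞ (n : ℤ)) I) I = 0) :
    ∀ᵐ t ∂circleMeasure, ‖I t‖ = 1 := by
  have hsq : Integrable (fun t => ‖I t‖ ^ 2) circleMeasure := (Lp.memLp I).integrable_norm_pow
    (by norm_num)
  have hmeas : Measurable fun t => ENNReal.ofReal (‖I t‖ ^ 2) :=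
    ((Lp.stronglyMeasurable I).norm.measurable.pow_const 2).ennreal_ofReal
  have hinner : ∀ n : ℤ, inner ℂ (mulOp (fourierLp ∞ n) I) I =
      ∫ t, (‖I t‖ ^ 2 : ℝ) • (fourier (-n) t : ℂ) ∂circleMeasure := by
    intro n
    rw [L2.inner_def]
    refine integral_congr_ae ?_
    filter_upwards [coeFn_shift n I] with t h1
    rw [h1, fourier_neg, RCLike.inner_apply, map_mul, Complex.real_smul]
    push_cast
    rw [← Complex.mul_conj']
    ring
  have hzero : ∀ n : ℤ, n ≠ 0 → inner ℂ (mulOp (fourierLp ∞ n) I) I = 0 := by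
    intro n hn
    rcases lt_or_gt_of_ne hn with hn | hn
    · rw [inner_mulOp_left, star_fourierLp, ← inner_conj_symm]
      obtain ⟨k, hk⟩ := Int.eq_ofNat_of_zero_le (show 0 ≤ -n by omega)
      rw [hk, h k (by omega), map_zero]
    · obtain ⟨k, rfl⟩ := Int.eq_ofNat_of_zero_le hn.le
      exact h k (by omega)
  -- The inner products `⟨zⁿI, I⟩` are the Fourier coefficients of `|I|² dm`; they agree with those
  -- of `dm`, so the density is `1`.
  set ν := circleMeasure.withDensity fun t => ENNReal.ofReal (‖I t‖ ^ 2) with hν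
  have : IsFiniteMeasure ν := isFiniteMeasure_withDensity_ofReal hsq.2
  have hνμ : ν = circleMeasure := by
    refine measure_ext_of_integral_fourier fun n => ?_
    rw [hν, integral_withDensity_eq_integral_toReal_smul hmeas (.of_forall fun t => by simp)]
    have h1 : ∫ t, (ENNReal.ofReal (‖I t‖ ^ 2)).toReal • (fourier n t : ℂ) ∂circleMeasure =
        inner ℂ (mulOp (fourierLp ∞ (-n)) I) I := by
      rw [hinner, neg_neg]
      refine integral_congr_ae (.of_forall fun t => ?_)
      simp only
      rw [ENNReal.toReal_ofReal (by positivity)]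
    have h2 : ∫ t, (fourier n t : ℂ) ∂circleMeasure = if n = 0 then 1 else 0 := by
      have := fourierCoeff_fourierLp n 0
      rw [fourierCoeff_congr_ae (coeFn_fourierLp (T := (1 : ℝ)) 2 n)] at this
      refine Eq.trans (integral_congr_ae (.of_forall fun t => ?_)) (this.trans (by simp [eq_comm]))
      change _ = fourier (-0) t • fourier n t
      rw [neg_zero, fourier_zero, one_smul]
    rw [h1, h2]
    split_ifs with hn
    · subst hn
      rw [neg_zero, shift_zero, inner_self_eq_norm_sq_to_K, hI]
      simp
    · exact hzero _ (by omega)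
  have h1 : (fun t => ENNReal.ofReal (‖I t‖ ^ 2)) =ᵐ[circleMeasure] 1 := by
    refine (withDensity_eq_iff_of_sigmaFinite hmeas.aemeasurable aemeasurable_const).mp ?_
    rw [← hν, hνμ]
    exact withDensity_one.symm
  filter_upwards [h1] with t ht
  have : ‖I t‖ ^ 2 = 1 := ENNReal.ofReal_eq_one.mp ht
  exact (pow_eq_one_iff_of_nonneg (norm_nonneg _) two_ne_zero).mp this

theorem mulOp_star_mulOp {θ : Linf} (hθ : ∀ᵐ t ∂circleMeasure, ‖θ t‖ = 1) (f : L2) :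
    mulOp (star θ) (mulOp θ f) = f := by
  refine Lp.ext ?_
  filter_upwards [coeFn_mulOp (star θ) (mulOp θ f), coeFn_mulOp θ f, Lp.coeFn_star θ, hθ]
    with t h1 h2 h3 h4
  rw [h1, h2, h3, Pi.star_apply, RCLike.star_def, ← mul_assoc, Complex.conj_mul', h4]
  simp

theorem mulOp_mulOp_star {θ : Linf} (hθ : ∀ᵐ t ∂circleMeasure, ‖θ t‖ = 1) (f : L2) :
    mulOp θ (mulOp (star θ) f) = f := by
  rw [mulOp_comm, mulOp_star_mulOp hθ]

/-- The defect vector of a nonzero `H²` function: a nonzero vector of the cyclic subspace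
orthogonal to all proper shifts of the function. -/
theorem exists_wandering_vector {φ : L2} (hφ : φ ∈ H2Plus) (h0 : φ ≠ 0) :
    ∃ I ∈ cyclicSubspace φ, ‖I‖ = 1 ∧ ∀ n : ℕ, n ≠ 0 →
      ∀ u ∈ cyclicSubspace φ, inner ℂ (mulOp (fourierLp ∞ (n : ℤ)) u) I = 0 := by
  set N := cyclicSubspace (mulOp (fourierLp ∞ 1) φ) with hN
  have hNφ : N ≤ cyclicSubspace φ := by
    refine cyclicSubspace_le (isClosed_cyclicSubspace φ) fun n => ?_
    exact shift_mem_cyclicSubspace_of_mem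
      (by exact_mod_cast shift_mem_cyclicSubspace φ 1) n
  have hshift : ∀ n : ℕ, n ≠ 0 → ∀ u ∈ cyclicSubspace φ, mulOp (fourierLp ∞ (n : ℤ)) u ∈ N := by
    intro n hn
    refine cyclicSubspace_le_comap (isClosed_cyclicSubspace _) _ fun k => ?_
    obtain ⟨m, rfl⟩ := Nat.exists_eq_succ_of_ne_zero hn
    have := shift_mem_cyclicSubspace (mulOp (fourierLp ∞ 1) φ) (m + k)
    rw [shift_add] at this ⊢
    convert this using 4
    push_cast
    ring
  have : CompleteSpace N := (isClosed_cyclicSubspace _).completeSpace_coe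
  set J := φ - N.starProjection φ with hJ
  have hJN : J ∈ Nᗮ := Submodule.sub_starProjection_mem_orthogonal φ
  have hJφ : J ∈ cyclicSubspace φ := Submodule.sub_mem _ (self_mem_cyclicSubspace φ)
    (hNφ (Submodule.starProjection_apply_mem N φ))
  have hJ0 : J ≠ 0 := by
    intro hz
    -- If `φ` were in the span of its proper shifts, the cyclic subspace would be invariant under
    -- `z⁻¹`. Then all `z⁻ᵏφ` lie in `H²₊`, so every coefficient of `φ` vanishes.
    have hφN : φ ∈ N := by
      rw [sub_eq_zero.mp (hJ.symm.trans hz)]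
      exact Submodule.starProjection_apply_mem N φ
    have hback : ∀ u ∈ cyclicSubspace φ, mulOp (fourierLp ∞ (-1)) u ∈ cyclicSubspace φ := by
      intro u hu
      have huN : u ∈ N := cyclicSubspace_le (isClosed_cyclicSubspace _)
        (fun n => shift_mem_cyclicSubspace_of_mem hφN n) hu
      refine cyclicSubspace_le_comap (isClosed_cyclicSubspace φ) _ (fun n => ?_) u huN
      rw [shift_add, shift_add, neg_add_cancel_comm]
      exact shift_mem_cyclicSubspace φ n
    have hall : ∀ k : ℕ, mulOp (fourierLp ∞ (-(k : ℤ))) φ ∈ cyclicSubspace φ := by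
      intro k
      induction k with
      | zero => simpa [shift_zero] using self_mem_cyclicSubspace φ
      | succ k ih =>
        have := hback _ ih
        rw [shift_add] at this
        convert this using 4
        push_cast
        ring
    refine h0 (L2_eq_zero_of_fourierCoeff fun n => ?_)
    -- Shifting back by `|n| + 1` moves the coefficient of index `n` to a negative index.
    have h1 := cyclicSubspace_le_H2Plus hφ (hall (n.natAbs + 1)) (n - (n.natAbs + 1)) (by omega)
    rw [fourierCoeff_shift] at h1
    convert h1 using 2
    push_cast
    ring
  have hnJ : (‖J‖ : ℂ) ≠ 0 := by exact_mod_cast norm_ne_zero_iff.mpr hJ0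
  refine ⟨(‖J‖ : ℂ)⁻¹ • J, Submodule.smul_mem _ _ hJφ, norm_smul_inv_norm hJ0, ?_⟩
  intro n hn u hu
  rw [inner_smul_right, (Submodule.mem_orthogonal _ _).mp hJN _ (hshift n hn u hu), mul_zero]

/-- Inner-outer factorization in `H²`. -/
theorem exists_inner_outer_factorization {φ : L2} (hφ : φ ∈ H2Plus) (h0 : φ ≠ 0) :
    ∃ θ : Linf, IsInner θ ∧ ∃ O : L2, IsOuterPlus O ∧ φ = mulOp θ O := by
  obtain ⟨I, hIφ, hI1, hI⟩ := exists_wandering_vector hφ h0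
  have hu : ∀ᵐ t ∂circleMeasure, ‖I t‖ = 1 :=
    ae_norm_eq_one_of_orthogonal_shift hI1 fun n hn => hI n hn I hIφ
  have hmem : MemLp I ∞ circleMeasure :=
    memLp_top_of_bound (Lp.aestronglyMeasurable I) 1 (hu.mono fun t ht => ht.le)
  set θ : Linf := hmem.toLp I with hθ
  have hθI : θ =ᵐ[circleMeasure] I := hmem.coeFn_toLp
  have hθL2 : toL2 θ = I := Lp.ext ((coeFn_toL2 θ).trans hθI)
  have hθ1 : ∀ᵐ t ∂circleMeasure, ‖θ t‖ = 1 := by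
    filter_upwards [hθI, hu] with t h1 h2
    rw [h1, h2]
  have hθinf : IsHInf θ := isHInf_iff.mpr (hθL2 ▸ cyclicSubspace_le_H2Plus hφ hIφ)
  refine ⟨θ, ⟨hθinf, hθ1⟩, mulOp (star θ) φ, isOuterPlus_iff.mpr ⟨?_, ?_⟩,
    (mulOp_mulOp_star hθ1 φ).symm⟩
  -- For `n < 0` the coefficient of `θ̄φ` is `⟨zⁿI, φ⟩ = ⟨I, z⁻ⁿφ⟩`, zero because `I` is orthogonal
  -- to proper shifts.
  · intro n hn
    obtain ⟨k, hk⟩ := Int.eq_ofNat_of_zero_le (show 0 ≤ -n by omega)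
    rw [fourierCoeff_eq_inner, ← inner_mulOp_left, ← add_zero n, ← shift_fourierLp, mulOp_comm,
      mulOp_fourierLp_zero, hθL2, inner_mulOp_left, star_fourierLp, ← inner_conj_symm, hk,
      hI k (by omega) φ (self_mem_cyclicSubspace φ), map_zero]
  -- `I` is a limit of polynomial multiples of `φ`; multiplying by `θ̄` makes `θ̄I = 1` a limit of
  -- polynomial multiples of `θ̄φ`.
  · have h1 := cyclicSubspace_le_comap (isClosed_cyclicSubspace (mulOp (star θ) φ))
      (mulOp (star θ)) (fun n => by
        rw [mulOp_comm]
        exact shift_mem_cyclicSubspace (mulOp (star θ) φ) n) I hIφ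
    rwa [← hθL2, ← mulOp_fourierLp_zero, mulOp_star_mulOp hθ1] at h1

/-- Dividing an outer function by a nonconstant inner function leaves `H²`. -/
theorem IsOuterPlus.inner_eq_const {ψ : L2} (hψ : IsOuterPlus ψ) {θ : Linf} (hθ : IsInner θ)
    (h : mulOp (star θ) ψ ∈ H2Plus) : ∃ c : ℂ, ∀ᵐ t ∂circleMeasure, θ t = c := by
  have h1 : toL2 (star θ) ∈ H2Plus := by
    refine hψ.mem_H2Plus_of_product fun n hn => ?_
    rw [productCoeff_congr (f' := fourierLp 2 0) (g' := mulOp (star θ) ψ), productCoeff_one]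
    · exact h n hn
    · filter_upwards [coeFn_toL2 (star θ), coeFn_mulOp (star θ) ψ,
        coeFn_fourierLp (T := (1 : ℝ)) 2 0] with t h1 h2 h3
      rw [h1, h2, h3, fourier_zero, one_mul, mul_comm]
  have h2 : star (toL2 θ) = toL2 (star θ) := by
    refine Lp.ext ?_
    filter_upwards [Lp.coeFn_star (toL2 θ), coeFn_toL2 θ, coeFn_toL2 (star θ), Lp.coeFn_star θ]
      with t h1 h2 h3 h4
    rw [h1, h3, h4, Pi.star_apply, h2, Pi.star_apply]
  -- Both `θ` and `θ̄` are analytic, so only the coefficient of index `0` survives.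
  have h3 : toL2 θ - fourierCoeff (toL2 θ) 0 • (fourierLp 2 0 : L2) = 0 := by
    refine L2_eq_zero_of_fourierCoeff fun n => ?_
    rw [fourierCoeff_eq_inner, inner_sub_right, inner_smul_right, ← fourierCoeff_eq_inner,
      ← fourierCoeff_eq_inner, fourierCoeff_fourierLp]
    split_ifs with hn
    · subst hn
      ring
    · rw [mul_zero, sub_zero]
      rcases lt_or_gt_of_ne hn with hn | hn
      · exact isHInf_iff.mp hθ.1 n hn
      · have := h1 (-n) (by omega)
        rwa [← h2, fourierCoeff_star, neg_neg, star_eq_zero] at this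
  refine ⟨fourierCoeff (toL2 θ) 0, ?_⟩
  have h4 := sub_eq_zero.mp h3
  filter_upwards [coeFn_toL2 θ, coeFn_fourierLp (T := (1 : ℝ)) 2 0,
    Lp.coeFn_smul (fourierCoeff (toL2 θ) 0) (fourierLp 2 0 : L2)] with t h5 h6 h7
  rw [← h5]
  nth_rw 1 [h4]
  rw [h7, Pi.smul_apply, h6, fourier_zero, smul_eq_mul, mul_one]

/-! ### The kernel of `Σ_{a,b}`. -/

theorem mem_kerSigma {a b : Linf} {f : L2} :
    f ∈ kerSigma a b ↔ mulOp a f ∈ H2Minus ∧ mulOp b f ∈ H2Plus := by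
  change projPlus (mulOp a f) + projMinus (mulOp b f) = 0 ↔ _
  have hp : projPlus (mulOp a f) ∈ H2Plus := Submodule.starProjection_apply_mem _ _
  have hm : projMinus (mulOp b f) ∈ H2Plusᗮ := Submodule.starProjection_apply_mem _ _
  have e1 : projPlus (mulOp a f) = 0 ↔ mulOp a f ∈ H2Minus :=
    Submodule.starProjection_apply_eq_zero_iff _
  have e2 : projMinus (mulOp b f) = 0 ↔ mulOp b f ∈ H2Plus := by
    refine (Submodule.starProjection_apply_eq_zero_iff _).trans ?_
    rw [H2Minus, Submodule.orthogonal_orthogonal]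
  rw [← e1, ← e2]
  constructor
  · intro h
    have h1 : projPlus (mulOp a f) = -projMinus (mulOp b f) := eq_neg_of_add_eq_zero_left h
    have h0 : projPlus (mulOp a f) = 0 := by
      have : projPlus (mulOp a f) ∈ H2Plusᗮ := h1 ▸ Submodule.neg_mem _ hm
      exact (Submodule.disjoint_def.mp H2Plus.orthogonal_disjoint) _ hp this
    exact ⟨h0, by rwa [h0, zero_add] at h⟩
  · rintro ⟨h1, h2⟩
    rw [h1, h2, add_zero]

/-! ### Reflection between `H²₊` and `H²₋`. -/

/-- The conjugate-linear involution `f ↦ z̄ f̄`, which exchanges `H²₊` and `H²₋`. -/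
noncomputable def conjReflect (f : L2) : L2 := mulOp (fourierLp ∞ (-1)) (star f)

theorem coeFn_conjReflect (f : L2) :
    conjReflect f =ᵐ[circleMeasure] fun t => fourier (-1) t * star (f t) := by
  filter_upwards [coeFn_shift (-1) (star f), Lp.coeFn_star f] with t h1 h2
  rw [conjReflect, h1, h2, Pi.star_apply]

theorem fourierCoeff_conjReflect (f : L2) (n : ℤ) :
    fourierCoeff (conjReflect f) n = star (fourierCoeff f (-n - 1)) := by
  rw [conjReflect, fourierCoeff_shift, fourierCoeff_star]
  congr 2
  ring

theorem conjReflect_conjReflect (f : L2) : conjReflect (conjReflect f) = f := by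
  refine Lp.ext ?_
  filter_upwards [coeFn_conjReflect (conjReflect f), coeFn_conjReflect f] with t h1 h2
  rw [h1, h2, star_mul', star_star, RCLike.star_def, ← fourier_neg, ← mul_assoc, ← fourier_add]
  simp only [neg_neg, neg_add_cancel]
  rw [fourier_zero, one_mul]

theorem conjReflect_mem_H2Plus {f : L2} : conjReflect f ∈ H2Plus ↔ f ∈ H2Minus := by
  rw [mem_H2Plus, mem_H2Minus]
  simp only [fourierCoeff_conjReflect, star_eq_zero]
  constructor
  · intro h n hn
    convert h (-n - 1) (by omega) using 2
    ring
  · intro h n hn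
    exact h _ (by omega)

theorem conjReflect_mem_H2Minus {f : L2} : conjReflect f ∈ H2Minus ↔ f ∈ H2Plus := by
  rw [← conjReflect_mem_H2Plus, conjReflect_conjReflect]

theorem isOuterMinus_iff {f : L2} : IsOuterMinus f ↔ IsOuterPlus (conjReflect f) := Iff.rfl

theorem conjReflect_mulOp (a : Linf) (f : L2) :
    conjReflect (mulOp a f) = mulOp (star a) (conjReflect f) := by
  refine Lp.ext ?_
  filter_upwards [coeFn_conjReflect (mulOp a f), coeFn_mulOp a f, coeFn_conjReflect f,
    coeFn_mulOp (star a) (conjReflect f), Lp.coeFn_star a] with t h1 h2 h3 h4 h5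
  rw [h1, h2, h4, h5, h3, Pi.star_apply, star_mul', mul_left_comm]

/-- Reflection swaps and conjugates the symbols, so each claim about `a` and `H²₋` reduces to one
about `b` and `H²₊`. -/
theorem conjReflect_mem_kerSigma {a b : Linf} {f : L2} :
    conjReflect f ∈ kerSigma (star b) (star a) ↔ f ∈ kerSigma a b := by
  rw [mem_kerSigma, mem_kerSigma, ← conjReflect_mulOp, ← conjReflect_mulOp,
    conjReflect_mem_H2Minus, conjReflect_mem_H2Plus, and_comm]

theorem kerSigma_star_le_iff {a b a' b' : Linf} :
    kerSigma (star b) (star a) ≤ kerSigma (star b') (star a') ↔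
      kerSigma a b ≤ kerSigma a' b' := by
  constructor
  · intro h f hf
    exact conjReflect_mem_kerSigma.mp (h (conjReflect_mem_kerSigma.mpr hf))
  · intro h f hf
    rw [← conjReflect_conjReflect f, conjReflect_mem_kerSigma] at hf ⊢
    exact h hf

theorem kerSigma_star_ne_bot {a b : Linf} (h : kerSigma a b ≠ ⊥) :
    kerSigma (star b) (star a) ≠ ⊥ := by
  obtain ⟨f, hf, h0⟩ := (Submodule.ne_bot_iff _).mp h
  refine (Submodule.ne_bot_iff _).mpr ⟨conjReflect f, conjReflect_mem_kerSigma.mpr hf, ?_⟩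
  intro hz
  have hz' : conjReflect f = conjReflect 0 := by
    rw [hz]
    refine (L2_eq_zero_of_fourierCoeff fun n => ?_).symm
    rw [fourierCoeff_conjReflect, ← fourierBasis_repr, map_zero]
    simp
  exact h0 (by rw [← conjReflect_conjReflect f, hz', conjReflect_conjReflect])

theorem ae_star_ne_zero {a : Linf} (ha : ∀ᵐ t ∂circleMeasure, a t ≠ 0) :
    ∀ᵐ t ∂circleMeasure, (star a : Linf) t ≠ 0 := by
  filter_upwards [ha, Lp.coeFn_star a] with t h1 h2
  rwa [h2, Pi.star_apply, star_ne_zero]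

theorem star_div_eq_iff {a a' : Linf} {ψ ψ' : L2} :
    (∀ᵐ t ∂circleMeasure, (star a' : Linf) t / (star a : Linf) t =
        conjReflect ψ' t / conjReflect ψ t) ↔
      ∀ᵐ t ∂circleMeasure, a' t / a t = ψ' t / ψ t := by
  refine Filter.eventually_congr ?_
  filter_upwards [Lp.coeFn_star a, Lp.coeFn_star a', coeFn_conjReflect ψ, coeFn_conjReflect ψ']
    with t h1 h2 h3 h4
  rw [h1, h2, h3, h4, mul_div_mul_left, Pi.star_apply, Pi.star_apply, ← star_div₀, ← star_div₀,
    star_inj]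
  rw [fourier_apply]
  exact Circle.coe_ne_zero _

theorem exists_minus_iff {a a' : Linf} :
    (∃ ψm ∈ H2Minus, ∃ ψm' ∈ H2Minus, IsOuterMinus ψm ∧
        ∀ᵐ t ∂circleMeasure, a' t / a t = ψm' t / ψm t) ↔
      ∃ ψp ∈ H2Plus, ∃ ψp' ∈ H2Plus, IsOuterPlus ψp ∧
        ∀ᵐ t ∂circleMeasure, (star a' : Linf) t / (star a : Linf) t = ψp' t / ψp t := by
  constructor
  · rintro ⟨ψ, h1, ψ', h2, h3, h4⟩
    exact ⟨_, conjReflect_mem_H2Plus.mpr h1, _, conjReflect_mem_H2Plus.mpr h2, h3,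
      star_div_eq_iff.mpr h4⟩
  · rintro ⟨ψ, h1, ψ', h2, h3, h4⟩
    rw [← conjReflect_conjReflect ψ, ← conjReflect_conjReflect ψ', star_div_eq_iff] at h4
    refine ⟨_, conjReflect_mem_H2Minus.mpr h1, _, conjReflect_mem_H2Minus.mpr h2, ?_, h4⟩
    rwa [isOuterMinus_iff, conjReflect_conjReflect]

theorem exists_minus_outer_iff {a a' : Linf} :
    (∃ ψm ∈ H2Minus, ∃ ψm' ∈ H2Minus, IsOuterMinus ψm ∧ IsOuterMinus ψm' ∧
        ∀ᵐ t ∂circleMeasure, a' t / a t = ψm' t / ψm t) ↔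
      ∃ ψp ∈ H2Plus, ∃ ψp' ∈ H2Plus, IsOuterPlus ψp ∧ IsOuterPlus ψp' ∧
        ∀ᵐ t ∂circleMeasure, (star a' : Linf) t / (star a : Linf) t = ψp' t / ψp t := by
  constructor
  · rintro ⟨ψ, h1, ψ', h2, h3, h3', h4⟩
    exact ⟨_, conjReflect_mem_H2Plus.mpr h1, _, conjReflect_mem_H2Plus.mpr h2, h3, h3',
      star_div_eq_iff.mpr h4⟩
  · rintro ⟨ψ, h1, ψ', h2, h3, h3', h4⟩
    rw [← conjReflect_conjReflect ψ, ← conjReflect_conjReflect ψ', star_div_eq_iff] at h4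
    refine ⟨_, conjReflect_mem_H2Minus.mpr h1, _, conjReflect_mem_H2Minus.mpr h2, ?_, ?_, h4⟩
    · rwa [isOuterMinus_iff, conjReflect_conjReflect]
    · rwa [isOuterMinus_iff, conjReflect_conjReflect]

/-! ### Quotients of symbols from kernel inclusion and equality. -/

theorem ae_eq_zero_of_mulOp_eq_zero {a : Linf} {f : L2} (h : mulOp a f = 0) :
    ∀ᵐ t ∂circleMeasure, a t * f t = 0 := by
  filter_upwards [coeFn_mulOp a f, Lp.coeFn_zero ℂ 2 circleMeasure] with t h1 h2
  rw [← h1, h, h2, Pi.zero_apply]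

theorem kerSigma_divide_inner {a b θ : Linf} {f : L2} (hθ : IsInner θ)
    (ha : mulOp a f ∈ H2Minus) (hb : mulOp b (mulOp (star θ) f) ∈ H2Plus) :
    mulOp (star θ) f ∈ kerSigma a b := by
  refine mem_kerSigma.mpr ⟨?_, hb⟩
  rw [mulOp_comm]
  exact hθ.1.mulOp_star_mem_H2Minus ha

theorem exists_mem_kerSigma_isOuterPlus {a b : Linf} (hb : ∀ᵐ t ∂circleMeasure, b t ≠ 0)
    (hker : kerSigma a b ≠ ⊥) : ∃ f ∈ kerSigma a b, IsOuterPlus (mulOp b f) := by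
  obtain ⟨f, hf, h0⟩ := (Submodule.ne_bot_iff _).mp hker
  rw [mem_kerSigma] at hf
  have hne : mulOp b f ≠ 0 := by
    intro hz
    refine h0 (Lp.ext ?_)
    filter_upwards [ae_eq_zero_of_mulOp_eq_zero hz, hb, Lp.coeFn_zero ℂ 2 circleMeasure]
      with t h1 h2 h3
    rw [h3, (mul_eq_zero.mp h1).resolve_left h2, Pi.zero_apply]
  obtain ⟨θ, hθ, O, hO, h⟩ := exists_inner_outer_factorization hf.2 hne
  have hbO : mulOp b (mulOp (star θ) f) = O := by
    rw [mulOp_comm, h, mulOp_star_mulOp hθ.2]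
  refine ⟨mulOp (star θ) f, kerSigma_divide_inner hθ hf.1 ?_, hbO ▸ hO⟩
  rw [hbO]
  exact (isOuterPlus_iff.mp hO).1

theorem div_eq_mulOp_div {b b' : Linf} {f : L2} (h : IsOuterPlus (mulOp b f)) :
    ∀ᵐ t ∂circleMeasure, b' t / b t = mulOp b' f t / mulOp b f t := by
  filter_upwards [h.ae_ne_zero, coeFn_mulOp b f, coeFn_mulOp b' f] with t h1 h2 h3
  rw [h2] at h1
  rw [h2, h3, mul_div_mul_right _ _ (right_ne_zero_of_mul h1)]

theorem exists_plus_of_kerSigma_le {a b a' b' : Linf} (hb : ∀ᵐ t ∂circleMeasure, b t ≠ 0)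
    (hker : kerSigma a b ≠ ⊥) (hle : kerSigma a b ≤ kerSigma a' b') :
    ∃ ψp ∈ H2Plus, ∃ ψp' ∈ H2Plus, IsOuterPlus ψp ∧
      ∀ᵐ t ∂circleMeasure, b' t / b t = ψp' t / ψp t := by
  obtain ⟨f, hf, hO⟩ := exists_mem_kerSigma_isOuterPlus hb hker
  exact ⟨_, (mem_kerSigma.mp hf).2, _, (mem_kerSigma.mp (hle hf)).2, hO, div_eq_mulOp_div hO⟩

theorem mulOp_mem_H2Plus_of_div {b b' : Linf} (hb : ∀ᵐ t ∂circleMeasure, b t ≠ 0) {ψ ψ' f : L2}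
    (hψ' : ψ' ∈ H2Plus) (hψ : IsOuterPlus ψ)
    (h : ∀ᵐ t ∂circleMeasure, b' t / b t = ψ' t / ψ t) (hf : mulOp b f ∈ H2Plus) :
    mulOp b' f ∈ H2Plus := by
  refine hψ.mem_H2Plus_of_product fun n hn => ?_
  rw [productCoeff_congr (f' := ψ') (g' := mulOp b f)]
  · exact productCoeff_eq_zero hψ' hf n hn
  · filter_upwards [h, hb, hψ.ae_ne_zero, coeFn_mulOp b f, coeFn_mulOp b' f] with t h1 h2 h3 h4 h5
    rw [div_eq_div_iff h2 h3] at h1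
    rw [h4, h5]
    linear_combination f t * h1

theorem mulOp_mem_H2Minus_of_div {a a' : Linf} (ha : ∀ᵐ t ∂circleMeasure, a t ≠ 0) {ψ ψ' f : L2}
    (hψ' : ψ' ∈ H2Minus) (hψ : IsOuterMinus ψ)
    (h : ∀ᵐ t ∂circleMeasure, a' t / a t = ψ' t / ψ t) (hf : mulOp a f ∈ H2Minus) :
    mulOp a' f ∈ H2Minus := by
  rw [← conjReflect_mem_H2Plus, conjReflect_mulOp] at hf ⊢
  exact mulOp_mem_H2Plus_of_div (ae_star_ne_zero ha) (conjReflect_mem_H2Plus.mpr hψ')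
    (isOuterMinus_iff.mp hψ) (star_div_eq_iff.mpr h) hf

/-- If `b'f = 0`, all `z⁻ᵏf` lie in the second kernel, since `H²₋` is stable under `z⁻¹`. Being in
the first as well, they force `bf = 0`. This permits factoring `b'f`, although `b'` may vanish on a
set of positive measure. -/
theorem mulOp_ne_zero_of_kerSigma_eq {a b a' b' : Linf} (heq : kerSigma a b = kerSigma a' b')
    {f : L2} (hf : f ∈ kerSigma a b) (hO : IsOuterPlus (mulOp b f)) : mulOp b' f ≠ 0 := by
  intro hz
  have hback : ∀ k : ℕ, mulOp (fourierLp ∞ (-(k : ℤ))) f ∈ kerSigma a b := by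
    intro k
    rw [heq, mem_kerSigma] at hf ⊢
    rw [mulOp_comm, mulOp_comm b', hz, map_zero]
    refine ⟨?_, Submodule.zero_mem _⟩
    rw [mem_H2Minus]
    intro n hn
    rw [fourierCoeff_shift]
    exact mem_H2Minus.mp hf.1 _ (by omega)
  refine hO.ne_zero (L2_eq_zero_of_fourierCoeff fun n => ?_)
  have h1 := (mem_kerSigma.mp (hback (n.natAbs + 1))).2 (n - (n.natAbs + 1)) (by omega)
  rw [mulOp_comm, fourierCoeff_shift] at h1
  convert h1 using 2
  push_cast
  ring

theorem exists_plus_outer_of_kerSigma_eq {a b a' b' : Linf}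
    (hb : ∀ᵐ t ∂circleMeasure, b t ≠ 0) (hker : kerSigma a b ≠ ⊥)
    (heq : kerSigma a b = kerSigma a' b') :
    ∃ ψp ∈ H2Plus, ∃ ψp' ∈ H2Plus, IsOuterPlus ψp ∧ IsOuterPlus ψp' ∧
      ∀ᵐ t ∂circleMeasure, b' t / b t = ψp' t / ψp t := by
  obtain ⟨f, hf, hO⟩ := exists_mem_kerSigma_isOuterPlus hb hker
  have hf' := mem_kerSigma.mp (heq ▸ hf)
  obtain ⟨θ, hθ, O, hO', h⟩ :=
    exists_inner_outer_factorization hf'.2 (mulOp_ne_zero_of_kerSigma_eq heq hf hO)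
  have hbO : mulOp b' (mulOp (star θ) f) = O := by
    rw [mulOp_comm, h, mulOp_star_mulOp hθ.2]
  have hmem : mulOp (star θ) f ∈ kerSigma a b := by
    rw [heq]
    refine kerSigma_divide_inner hθ hf'.1 ?_
    rw [hbO]
    exact (isOuterPlus_iff.mp hO').1
  -- Now `θ̄ · bf ∈ H²₊` with `bf` outer, so the inner factor `θ` of `b'f` is constant.
  have hconst := (mem_kerSigma.mp hmem).2
  rw [mulOp_comm] at hconst
  obtain ⟨c, hc⟩ := hO.inner_eq_const hθ hconst
  have hc0 : c ≠ 0 := by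
    rintro rfl
    obtain ⟨t, h1, h2⟩ := (hc.and hθ.2).exists
    rw [h1, norm_zero] at h2
    exact zero_ne_one h2
  have hsmul : mulOp b' f = c • O := by
    rw [h]
    refine Lp.ext ?_
    filter_upwards [coeFn_mulOp θ O, Lp.coeFn_smul c O, hc] with t h1 h2 h3
    rw [h1, h2, h3, Pi.smul_apply, smul_eq_mul]
  exact ⟨_, (isOuterPlus_iff.mp hO).1, _, hf'.2, hO, hsmul ▸ hO'.smul hc0, div_eq_mulOp_div hO⟩

/-- Lets the inclusion criterion be applied with the two pairs of symbols exchanged, for the reverse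
inclusion. -/
theorem ae_ne_zero_of_div {b b' : Linf} {ψ ψ' : L2} (hψ : ∀ᵐ t ∂circleMeasure, ψ t ≠ 0)
    (hψ' : ∀ᵐ t ∂circleMeasure, ψ' t ≠ 0)
    (h : ∀ᵐ t ∂circleMeasure, b' t / b t = ψ' t / ψ t) : ∀ᵐ t ∂circleMeasure, b' t ≠ 0 := by
  filter_upwards [hψ, hψ', h] with t h1 h2 h3 h4
  rw [h4, zero_div] at h3
  exact div_ne_zero h2 h1 h3.symm

theorem ae_div_symm {b b' : Linf} {ψ ψ' : L2}
    (h : ∀ᵐ t ∂circleMeasure, b' t / b t = ψ' t / ψ t) :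
    ∀ᵐ t ∂circleMeasure, b t / b' t = ψ t / ψ' t := by
  filter_upwards [h] with t h1
  rw [← inv_div, h1, inv_div]

theorem IsOuterMinus.ae_ne_zero {ψ : L2} (hψ : IsOuterMinus ψ) :
    ∀ᵐ t ∂circleMeasure, ψ t ≠ 0 := by
  filter_upwards [IsOuterPlus.ae_ne_zero hψ, coeFn_conjReflect ψ] with t h1 h2 h3
  refine h1 (h2.trans ?_)
  rw [h3, star_zero, mul_zero]

/-! ### Multiplying the symbols by `H^∞` functions. -/

theorem IsOuterPlus.mem_H2Plus_of_mulOp {h : Linf} {f : L2} (hh : IsOuterPlus (toL2 h))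
    (hf : mulOp h f ∈ H2Plus) : f ∈ H2Plus := by
  refine hh.mem_H2Plus_of_product fun n hn => ?_
  rw [productCoeff_congr (f' := fourierLp 2 0) (g' := mulOp h f), productCoeff_one]
  · exact hf n hn
  · filter_upwards [coeFn_toL2 h, coeFn_mulOp h f, coeFn_fourierLp (T := (1 : ℝ)) 2 0]
      with t h1 h2 h3
    rw [h1, h2, h3, fourier_zero, one_mul]

theorem kerSigma_le_linfMul (a b : Linf) {hm hp : Linf} (hhm : IsHInf (star hm))
    (hhp : IsHInf hp) : kerSigma a b ≤ kerSigma (linfMul a hm) (linfMul b hp) := by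
  intro f hf
  rw [mem_kerSigma] at hf ⊢
  rw [mulOp_linfMul, mulOp_linfMul, mulOp_comm, mulOp_comm b]
  refine ⟨?_, hhp.mulOp_mem_H2Plus hf.2⟩
  simpa using hhm.mulOp_star_mem_H2Minus hf.1

/-- With `bf` outer, the witness is `θ̄f`: `b θg · θ̄f = g · bf` is analytic, whereas `b · θ̄f` is
not unless `θ` is constant. -/
theorem not_linfMul_le_kerSigma {a b hm hp : Linf} (hb : ∀ᵐ t ∂circleMeasure, b t ≠ 0)
    (hker : kerSigma a b ≠ ⊥) (hhm : IsHInf (star hm)) (hhp : HasNonconstantInnerFactor hp) :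
    ¬ kerSigma (linfMul a hm) (linfMul b hp) ≤ kerSigma a b := by
  intro hle
  obtain ⟨θ, g, hθ, hnc, hg, rfl⟩ := hhp
  obtain ⟨f, hf, hO⟩ := exists_mem_kerSigma_isOuterPlus hb hker
  rw [mem_kerSigma] at hf
  have hmem : mulOp (star θ) f ∈ kerSigma (linfMul a hm) (linfMul b (linfMul θ g)) := by
    refine kerSigma_divide_inner hθ ?_ ?_
    · rw [mulOp_linfMul, mulOp_comm]
      simpa using hhm.mulOp_star_mem_H2Minus hf.1
    · rw [mulOp_linfMul, mulOp_linfMul, mulOp_comm θ, mulOp_mulOp_star hθ.2, mulOp_comm]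
      exact hg.mulOp_mem_H2Plus hf.2
  have := (mem_kerSigma.mp (hle hmem)).2
  rw [mulOp_comm] at this
  exact hnc (hO.inner_eq_const hθ this)

theorem linfMul_le_kerSigma {a b hm hp : Linf} (hhm : IsOuterInf (star hm))
    (hhp : IsOuterInf hp) : kerSigma (linfMul a hm) (linfMul b hp) ≤ kerSigma a b := by
  intro f hf
  rw [mem_kerSigma] at hf ⊢
  rw [mulOp_linfMul, mulOp_linfMul, mulOp_comm, mulOp_comm b] at hf
  refine ⟨?_, hhp.2.mem_H2Plus_of_mulOp hf.2⟩
  have := hf.1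
  rw [← conjReflect_mem_H2Plus, conjReflect_mulOp] at this
  exact conjReflect_mem_H2Plus.mp (hhm.2.mem_H2Plus_of_mulOp this)

/-! ### Combining the two halves. -/

theorem kerSigma_le_of_div {a b a' b' : Linf}
    (ha : ∀ᵐ t ∂circleMeasure, a t ≠ 0) (hb : ∀ᵐ t ∂circleMeasure, b t ≠ 0)
    {ψm ψm' ψp ψp' : L2} (hm' : ψm' ∈ H2Minus) (hm : IsOuterMinus ψm)
    (hma : ∀ᵐ t ∂circleMeasure, a' t / a t = ψm' t / ψm t)
    (hp' : ψp' ∈ H2Plus) (hp : IsOuterPlus ψp)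
    (hpb : ∀ᵐ t ∂circleMeasure, b' t / b t = ψp' t / ψp t) :
    kerSigma a b ≤ kerSigma a' b' := by
  intro f hf
  rw [mem_kerSigma] at hf ⊢
  exact ⟨mulOp_mem_H2Minus_of_div ha hm' hm hma hf.1, mulOp_mem_H2Plus_of_div hb hp' hp hpb hf.2⟩

theorem kerSigma_le_iff {a b : Linf}
    (ha : ∀ᵐ t ∂circleMeasure, a t ≠ 0) (hb : ∀ᵐ t ∂circleMeasure, b t ≠ 0)
    (hker : kerSigma a b ≠ ⊥) (a' b' : Linf) :
    kerSigma a b ≤ kerSigma a' b' ↔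
      (∃ ψm ∈ H2Minus, ∃ ψm' ∈ H2Minus, IsOuterMinus ψm ∧
        ∀ᵐ t ∂circleMeasure, a' t / a t = ψm' t / ψm t) ∧
      (∃ ψp ∈ H2Plus, ∃ ψp' ∈ H2Plus, IsOuterPlus ψp ∧
        ∀ᵐ t ∂circleMeasure, b' t / b t = ψp' t / ψp t) := by
  constructor
  · intro h
    exact ⟨exists_minus_iff.mpr (exists_plus_of_kerSigma_le (ae_star_ne_zero ha)
      (kerSigma_star_ne_bot hker) (kerSigma_star_le_iff.mpr h)),
      exists_plus_of_kerSigma_le hb hker h⟩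
  · rintro ⟨⟨ψm, -, ψm', hm', hm, hma⟩, ψp, -, ψp', hp', hp, hpb⟩
    exact kerSigma_le_of_div ha hb hm' hm hma hp' hp hpb

theorem kerSigma_eq_iff {a b : Linf}
    (ha : ∀ᵐ t ∂circleMeasure, a t ≠ 0) (hb : ∀ᵐ t ∂circleMeasure, b t ≠ 0)
    (hker : kerSigma a b ≠ ⊥) (a' b' : Linf) :
    kerSigma a b = kerSigma a' b' ↔
      (∃ ψm ∈ H2Minus, ∃ ψm' ∈ H2Minus, IsOuterMinus ψm ∧ IsOuterMinus ψm' ∧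
        ∀ᵐ t ∂circleMeasure, a' t / a t = ψm' t / ψm t) ∧
      (∃ ψp ∈ H2Plus, ∃ ψp' ∈ H2Plus, IsOuterPlus ψp ∧ IsOuterPlus ψp' ∧
        ∀ᵐ t ∂circleMeasure, b' t / b t = ψp' t / ψp t) := by
  constructor
  · intro h
    have hstar : kerSigma (star b) (star a) = kerSigma (star b') (star a') :=
      le_antisymm (kerSigma_star_le_iff.mpr h.le) (kerSigma_star_le_iff.mpr h.ge)
    exact ⟨exists_minus_outer_iff.mpr (exists_plus_outer_of_kerSigma_eq (ae_star_ne_zero ha)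
      (kerSigma_star_ne_bot hker) hstar), exists_plus_outer_of_kerSigma_eq hb hker h⟩
  · rintro ⟨⟨ψm, hm₀, ψm', hm₀', hm, hm', hma⟩, ψp, hp₀, ψp', hp₀', hp, hp', hpb⟩
    exact le_antisymm (kerSigma_le_of_div ha hb hm₀' hm hma hp₀' hp hpb)
      (kerSigma_le_of_div (ae_ne_zero_of_div hm.ae_ne_zero hm'.ae_ne_zero hma)
        (ae_ne_zero_of_div hp.ae_ne_zero hp'.ae_ne_zero hpb) hm₀ hm' (ae_div_symm hma)
        hp₀ hp' (ae_div_symm hpb))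

theorem kerSigma_lt_linfMul {a b hm hp : Linf}
    (ha : ∀ᵐ t ∂circleMeasure, a t ≠ 0) (hb : ∀ᵐ t ∂circleMeasure, b t ≠ 0)
    (hker : kerSigma a b ≠ ⊥) (hhm : IsHInf (star hm)) (hhp : IsHInf hp)
    (h : HasNonconstantInnerFactor (star hm) ∨ HasNonconstantInnerFactor hp) :
    kerSigma a b < kerSigma (linfMul a hm) (linfMul b hp) := by
  refine lt_of_le_not_ge (kerSigma_le_linfMul a b hhm hhp) ?_
  rcases h with h | h
  -- Reflection carries an inner factor of the conjugate of `hm` to the `H²₊` side.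
  · rw [← kerSigma_star_le_iff, linfMul_star, linfMul_star]
    exact not_linfMul_le_kerSigma (ae_star_ne_zero ha) (kerSigma_star_ne_bot hker)
      (by rwa [star_star]) h
  · exact not_linfMul_le_kerSigma hb hker hhm h

end TransposedPaired

theorem mainTheorem2 (a b : Linf)
    (ha : ∀ᵐ t ∂circleMeasure, a t ≠ 0)
    (hb : ∀ᵐ t ∂circleMeasure, b t ≠ 0)
    (hker : kerSigma a b ≠ ⊥) :
    (∀ a' b' : Linf,
      (kerSigma a b ≤ kerSigma a' b' ↔
        (∃ ψm ∈ H2Minus, ∃ ψm' ∈ H2Minus,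
          IsOuterMinus ψm ∧
          ∀ᵐ t ∂circleMeasure, a' t / a t = ψm' t / ψm t) ∧
        (∃ ψp ∈ H2Plus, ∃ ψp' ∈ H2Plus,
          IsOuterPlus ψp ∧
          ∀ᵐ t ∂circleMeasure, b' t / b t = ψp' t / ψp t)) ∧
      (kerSigma a b = kerSigma a' b' ↔
        (∃ ψm ∈ H2Minus, ∃ ψm' ∈ H2Minus,
          IsOuterMinus ψm ∧ IsOuterMinus ψm' ∧
          ∀ᵐ t ∂circleMeasure, a' t / a t = ψm' t / ψm t) ∧
        (∃ ψp ∈ H2Plus, ∃ ψp' ∈ H2Plus,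
          IsOuterPlus ψp ∧ IsOuterPlus ψp' ∧
          ∀ᵐ t ∂circleMeasure, b' t / b t = ψp' t / ψp t))) ∧
    (∀ hm hp : Linf,
      IsHInf (star hm) → IsHInf hp →
        kerSigma a b ≤
          kerSigma (linfMul a hm)
            (linfMul b hp) ∧
        (HasNonconstantInnerFactor (star hm) ∨
            HasNonconstantInnerFactor hp →
          kerSigma a b <
            kerSigma (linfMul a hm)
              (linfMul b hp)) ∧
        (IsOuterInf (star hm) → IsOuterInf hp →
          kerSigma a b =
            kerSigma (linfMul a hm)
              (linfMul b hp))) := by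
  refine ⟨fun a' b' => ⟨kerSigma_le_iff ha hb hker a' b', kerSigma_eq_iff ha hb hker a' b'⟩,
    fun hm hp hhm hhp => ⟨kerSigma_le_linfMul a b hhm hhp,
      kerSigma_lt_linfMul ha hb hker hhm hhp, fun h1 h2 =>
        le_antisymm (kerSigma_le_linfMul a b hhm hhp) (linfMul_le_kerSigma h1 h2)⟩⟩
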